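/- Let $m \ge 3$ be an integer. For a commutative ring $R$ consider in $R^m$ the subspaces $H_{ij} = \{x : x_i = x_j\}$ for $1 \le i < j \le m$, and $H_{pqrs} = \{x : x_p + x_q = x_r + x_s\}$ for distinct indices $p,q,r,s \in \{1,\dots,m\}$ with $p < q$ and $p < r < s$. The mid-hyperplane arrangement $\mathcal{A}_m$ is the set of all these hyperplanes for $R = \mathbb{R}$; for a prime $q$, its reduction $\mathcal{A}_{m,q}$ is the set of all these hyperplanes for $R = \mathbb{Z}/q\mathbb{Z}$, and $M(\mathcal{A}_{m,q})$ is the complement in $(\mathbb{Z}/q\mathbb{Z})^m$ of the union of the hyperplanes in $\mathcal{A}_{m,q}$. Let $L(\mathcal{A}_m)$ be the set of all intersections of hyperplanes of $\mathcal{A}_m$ (including the empty intersection $V = \mathbb{R}^m$), ordered by reverse inclusion, and let $\mu : L(\mathcal{A}_m) \to \mathbb{Z}$ be defined by $\mu(V) = 1$ and $\sum_{Y \le X} \mu(Y) = 0$ for $X > V$. The characteristic polynomial of $\mathcal{A}_m$ is $$\chi(\mathcal{A}_m, t) = \sum_{X \in L(\mathcal{A}_m)} \mu(X)\, t^{\dim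 X}.$$ Theorem. Let $q$ be a prime number with $q > 2^{m-2}$ if $m \le 5$, and $q > 8 \cdot 3^{m-5}$ if $m \ge 6$. Then $$\frac{\chi(\mathcal{A}_m, q)}{q(q-1)} = |M_1(m,q)|, \qquad M_1(m,q) := \{(0,1,x_3,\dots,x_m) \in M(\mathcal{A}_{m,q})\}.$$ -/

import Mathlib

namespace MidArrangement

section General

variable {K V : Type*} [Field K] [AddCommGroup V] [Module K V]

/-- The edges of an arrangement `A` of linear hyperplanes in `V`: all intersections of members
of `A`, the empty intersection being `V` itself.  (Every such intersection contains `0`, so it is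
nonempty.)  The order is reverse inclusion, whence the order dual. -/
def IntersectionPoset (A : Finset (Submodule K V)) : Type _ :=
  {X : (Submodule K V)ᵒᵈ // ∃ B : Finset (Submodule K V),
    B ⊆ A ∧ X = OrderDual.toDual (sInf (B : Set (Submodule K V)))}

namespace IntersectionPoset

variable {A : Finset (Submodule K V)}

/-- The linear subspace underlying an edge. -/
def toSubmodule (X : IntersectionPoset A) : Submodule K V := OrderDual.ofDual X.1

/-- `X ≤ Y` means `Y ⊆ X`. -/
instance : PartialOrder (IntersectionPoset A) := Subtype.partialOrder _

theorem le_iff (X Y : IntersectionPoset A) : X ≤ Y ↔ Y.toSubmodule ≤ X.toSubmodule := Iff.rfl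

/-- The unique minimal edge is the whole space `V`. -/
instance : OrderBot (IntersectionPoset A) where
  bot := ⟨OrderDual.toDual ⊤, ∅, by simp, by simp⟩
  bot_le X := (le_top : OrderDual.ofDual X.1 ≤ ⊤)

theorem bot_toSubmodule : (⊥ : IntersectionPoset A).toSubmodule = ⊤ := rfl

instance : Finite (IntersectionPoset A) := by
  have h : Function.Surjective (fun B : {B // B ∈ A.powerset} =>
      (⟨OrderDual.toDual (sInf (B.1 : Set (Submodule K V))), B.1,
        Finset.mem_powerset.1 B.2, rfl⟩ : IntersectionPoset A)) := by
    rintro ⟨X, B, hB, rfl⟩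
    exact ⟨⟨B, Finset.mem_powerset.2 hB⟩, rfl⟩
  exact Finite.of_surjective _ h

noncomputable instance : Fintype (IntersectionPoset A) := Fintype.ofFinite _

noncomputable instance : DecidableEq (IntersectionPoset A) := Classical.decEq _

open Classical in
noncomputable instance : LocallyFiniteOrder (IntersectionPoset A) :=
  Fintype.toLocallyFiniteOrder

/-- The Möbius function `μ(X) = μ(V, X)` of the intersection poset. -/
noncomputable def moebius (X : IntersectionPoset A) : ℤ := IncidenceAlgebra.mu ℤ ⊥ X

end IntersectionPoset

/-- The characteristic polynomial `χ(A, t) = ∑ μ(X) t ^ dim X`, the sum being over the edges. -/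
noncomputable def charPoly (A : Finset (Submodule K V)) : Polynomial ℤ :=
  ∑ X : IntersectionPoset A,
    Polynomial.C X.moebius * Polynomial.X ^ Module.finrank K X.toSubmodule

end General

section Mid

variable (R : Type*) [CommRing R] {m : ℕ}

/-- The points of `R ^ m` with `x i = x j`. -/
def braidHyperplane (i j : Fin m) : Submodule R (Fin m → R) where
  carrier := {x | x i = x j}
  add_mem' {x y} hx hy := by
    simp only [Set.mem_ofPred_eq, Pi.add_apply] at *
    rw [hx, hy]
  zero_mem' := rfl
  smul_mem' c x hx := by
    simp only [Set.mem_ofPred_eq, Pi.smul_apply] at *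
    rw [hx]

/-- The points of `R ^ m` with `x p + x q = x r + x s`. -/
def midHyperplane (p q r s : Fin m) : Submodule R (Fin m → R) where
  carrier := {x | x p + x q = x r + x s}
  add_mem' {x y} hx hy := by
    simp only [Set.mem_ofPred_eq, Pi.add_apply] at *
    linear_combination hx + hy
  zero_mem' := rfl
  smul_mem' c x hx := by
    simp only [Set.mem_ofPred_eq, Pi.smul_apply, smul_eq_mul] at *
    linear_combination c * hx

/-- The quadruples `(p, q, r, s)` of distinct indices with `p < q` and `p < r < s`
(so that only `q ≠ r` and `q ≠ s` remain to be required). -/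
def quadruples (m : ℕ) : Finset (Fin m × Fin m × Fin m × Fin m) :=
  {a | a.1 < a.2.1 ∧ a.1 < a.2.2.1 ∧ a.2.2.1 < a.2.2.2 ∧ a.2.1 ≠ a.2.2.1 ∧ a.2.1 ≠ a.2.2.2}

open Classical in
/-- The mid-hyperplane arrangement in `R ^ m`.  For `R = ℝ` it is the arrangement over the reals,
for `R = ZMod q` it is its reduction modulo `q`, given by the same equations. -/
noncomputable def midArrangement (m : ℕ) : Finset (Submodule R (Fin m → R)) :=
  (({a | a.1 < a.2} : Finset (Fin m × Fin m)).image fun a => braidHyperplane R a.1 a.2) ∪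
    ((quadruples m).image fun a => midHyperplane R a.1 a.2.1 a.2.2.1 a.2.2.2)

/-- The complement of an arrangement. -/
def complement {R V : Type*} [Semiring R] [AddCommMonoid V] [Module R V]
    (A : Finset (Submodule R V)) : Set V :=
  {x | ∀ H ∈ A, x ∉ H}

/-- The points of the form `(0, 1, x₃, …, x_m)` in the complement of the mid-hyperplane
arrangement modulo `q`. -/
def normalizedPoints (m : ℕ) (hm : 3 ≤ m) (q : ℕ) : Set (Fin m → ZMod q) :=
  {x | x ∈ complement (midArrangement (ZMod q) m) ∧ x ⟨0, by omega⟩ = 0 ∧ x ⟨1, by omega⟩ = 1}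

end Mid

end MidArrangement

/-! Whitney's formula writes `χ(t)` as the sum of `(-1)^|S| t^d(S)` over sets `S` of normals, with
`d(S)` the dimension of the intersection of their hyperplanes. Modulo `q`, that intersection has `q`
to the power of its dimension points, so inclusion-exclusion counts the complement by the same sum
at `t = q`, provided dimensions agree over `ℝ` and `ZMod q`. Both sums run over normals, so
hyperplanes that coincide modulo `q` do no harm. Dimensions agree when the same sets of normals are
independent over both fields. A nonzero minor modulo `q` is nonzero over `ℝ`. Conversely, a real
independent set extends, by a coordinate vector and further normals, to a square integer matrix with
determinant `D ≠ 0`. Normals have sum zero and squared length at most 4, so replacing the coordinate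
row by all ones multiplies `D` by `m`, and Hadamard gives `m D² ≤ 4^(m-1) < m q²`; hence `q ∤ D`.
Finally the affine maps `x ↦ a + b x`, `b ≠ 0`, act freely on the complement, which accounts for the
factor `q (q - 1)`. -/

namespace MidArrangement

/-! ### Determinant bounds -/

/-- Hadamard's inequality. -/
theorem abs_det_le_prod_norm {n : ℕ} (M : Matrix (Fin n) (Fin n) ℝ) :
    |M.det| ≤ ∏ i, ‖WithLp.toLp 2 (M i)‖ := by
  let b := EuclideanSpace.basisFun (Fin n) ℝ
  have : Fact (Module.finrank ℝ (EuclideanSpace ℝ (Fin n)) = n) := ⟨by simp⟩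
  have h := b.toBasis.orientation.abs_volumeForm_apply_le (fun i => WithLp.toLp 2 (M i))
  have hM : b.toBasis.toMatrix (fun i => WithLp.toLp 2 (M i)) = M.transpose := by
    ext i j
    simp [b, Module.Basis.toMatrix_apply]
  rwa [Orientation.volumeForm_robust' _ b, Module.Basis.det_apply, hM, Matrix.det_transpose] at h

theorem det_sq_le_prod {n : ℕ} (M : Matrix (Fin n) (Fin n) ℤ) :
    M.det ^ 2 ≤ ∏ i, ∑ j, M i j ^ 2 := by
  have h := abs_det_le_prod_norm (M.map (Int.cast : ℤ → ℝ))
  have h2 := pow_le_pow_left₀ (abs_nonneg _) h 2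
  rw [sq_abs, ← Finset.prod_pow] at h2
  have hdet : (M.map (Int.cast : ℤ → ℝ)).det = (M.det : ℝ) :=
    (Int.cast_det M).symm
  rw [hdet] at h2
  simp only [EuclideanSpace.norm_sq_eq, Matrix.map_apply, Real.norm_eq_abs, sq_abs] at h2
  exact_mod_cast h2

/-- A square integer matrix with one coordinate row and otherwise short rows of sum zero has
small determinant. -/
theorem mul_det_sq_le {m : ℕ} (M : Matrix (Fin m) (Fin m) ℤ) (i₀ j₀ : Fin m)
    (h₀ : M i₀ = Pi.single j₀ 1) (hsum : ∀ i, i ≠ i₀ → ∑ j, M i j = 0)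
    (hnorm : ∀ i, i ≠ i₀ → ∑ j, M i j ^ 2 ≤ 4) :
    (m : ℤ) * M.det ^ 2 ≤ 4 ^ (m - 1) := by
  have hrow : ∀ j, (M.updateRow i₀ (Pi.single j 1)).det = M.det := by
    intro j
    by_contra hne
    -- With the row `e_j - e_{j₀}` every row has sum zero, so the all-ones vector lies in the
    -- kernel.
    have hz : (M.updateRow i₀ (Pi.single j 1 - M i₀)).det = 0 := by
      refine Matrix.exists_mulVec_eq_zero_iff.1 ⟨1, fun h => ?_, ?_⟩
      · simpa using congrFun h i₀
      · ext i
        by_cases hi : i = i₀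
        · subst hi
          simp [Matrix.mulVec, dotProduct, h₀]
        · simpa [Matrix.mulVec, dotProduct, hi] using hsum i hi
    have := Matrix.det_updateRow_add M i₀ (Pi.single j 1 - M i₀) (M i₀)
    rw [sub_add_cancel, hz, Matrix.updateRow_eq_self] at this
    exact hne (by simpa using this)
  have hone : (M.updateRow i₀ 1).det = m * M.det := by
    have h1 : (1 : Fin m → ℤ) = ∑ j, Pi.single j 1 := by
      ext j; simp [Finset.sum_apply, Pi.single_apply]
    have := (Matrix.detRowAlternating (R := ℤ) (n := Fin m)).map_update_sum
      (Finset.univ) i₀ (fun j : Fin m => (Pi.single j 1 : Fin m → ℤ)) M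
    rw [← h1] at this
    change (M.updateRow i₀ 1).det = ∑ j, (M.updateRow i₀ (Pi.single j 1)).det at this
    simpa [hrow] using this
  have hle := det_sq_le_prod (M.updateRow i₀ 1)
  rw [hone, ← Finset.mul_prod_erase _ _ (Finset.mem_univ i₀)] at hle
  have hprod : ∏ i ∈ Finset.univ.erase i₀, ∑ j, (M.updateRow i₀ 1) i j ^ 2 ≤ 4 ^ (m - 1) := by
    refine (Finset.prod_le_prod (g := fun _ => (4 : ℤ))
      (fun i _ => Finset.sum_nonneg fun j _ => sq_nonneg _) fun i hi => ?_).trans (by simp)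
    simpa [Finset.ne_of_mem_erase hi] using hnorm i (Finset.ne_of_mem_erase hi)
  have hm : (0 : ℤ) < m := by exact_mod_cast i₀.pos
  have h4 : (m : ℤ) * (m * M.det ^ 2) ≤ m * 4 ^ (m - 1) := by
    calc (m : ℤ) * (m * M.det ^ 2) = (m * M.det) ^ 2 := by ring
      _ ≤ _ := hle
      _ ≤ _ := by
        simp only [Matrix.updateRow_self, Pi.one_apply, one_pow, Finset.sum_const,
          Finset.card_univ, Fintype.card_fin, nsmul_eq_mul, mul_one]
        exact mul_le_mul_of_nonneg_left hprod hm.le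
  exact le_of_mul_le_mul_left h4 hm

/-! ### Ranks of sets of normals over `ℝ` and modulo `q` -/

section Normals

variable {m : ℕ}

/-- The image of an integer vector in `K ^ m`. -/
def castVec (K : Type*) [Ring K] (v : Fin m → ℤ) : Fin m → K := fun i => (v i : K)

/-- The normal vectors of the mid-hyperplane arrangement. -/
def normals (m : ℕ) : Finset (Fin m → ℤ) :=
  (({a | a.1 < a.2} : Finset (Fin m × Fin m)).image
    fun a => Pi.single a.1 1 - Pi.single a.2 1) ∪
  ((quadruples m).image fun a =>
    Pi.single a.1 1 + Pi.single a.2.1 1 - Pi.single a.2.2.1 1 - Pi.single a.2.2.2 1)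

theorem mem_normals {v : Fin m → ℤ} : v ∈ normals m ↔
    (∃ i j, i < j ∧ v = Pi.single i 1 - Pi.single j 1) ∨
    ∃ p q r s, (p, q, r, s) ∈ quadruples m ∧
      v = Pi.single p 1 + Pi.single q 1 - Pi.single r 1 - Pi.single s 1 := by
  simp [normals, eq_comm]

theorem sum_eq_zero_of_mem_normals {v : Fin m → ℤ} (hv : v ∈ normals m) : ∑ j, v j = 0 := by
  rcases mem_normals.1 hv with ⟨i, j, -, rfl⟩ | ⟨p, q, r, s, -, rfl⟩ <;>
    simp [Finset.sum_add_distrib]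

theorem sum_sq_le_of_mem_normals {v : Fin m → ℤ} (hv : v ∈ normals m) : ∑ j, v j ^ 2 ≤ 4 := by
  rcases mem_normals.1 hv with ⟨i, j, hij, rfl⟩ | ⟨p, q, r, s, h, rfl⟩
  -- The indices are distinct, so entries are 0 or ±1 and squaring only removes the signs.
  · have h (x : Fin m) : (Pi.single i 1 - Pi.single j 1 : Fin m → ℤ) x ^ 2
        = (Pi.single i 1 + Pi.single j 1 : Fin m → ℤ) x := by
      simp only [Pi.sub_apply, Pi.add_apply, Pi.single_apply]
      split_ifs <;> omega
    rw [Finset.sum_congr rfl fun x _ => h x]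
    simp [Finset.sum_add_distrib]
  · have hx (x : Fin m) :
        (Pi.single p 1 + Pi.single q 1 - Pi.single r 1 - Pi.single s 1 : Fin m → ℤ) x ^ 2
        = (Pi.single p 1 + Pi.single q 1 + Pi.single r 1 + Pi.single s 1 : Fin m → ℤ) x := by
      simp only [quadruples, Finset.mem_filter, Finset.mem_univ, true_and] at h
      simp only [Pi.sub_apply, Pi.add_apply, Pi.single_apply]
      split_ifs <;> omega
    rw [Finset.sum_congr rfl fun x _ => hx x]
    simp [Finset.sum_add_distrib]

/-- A set of integer vectors which is linearly independent over `K` can be extended, by members of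
a spanning set, to the rows of a square integer matrix that is invertible over `K`. -/
theorem exists_matrix_of_linearIndepOn {K : Type*} [Field K] {s t : Set (Fin m → ℤ)}
    (hst : s ⊆ t) (hs : LinearIndepOn K (castVec K) s)
    (ht : Submodule.span K (castVec K '' t) = ⊤) :
    ∃ M : Matrix (Fin m) (Fin m) ℤ, Function.Injective M ∧ s ⊆ Set.range M ∧
      Set.range M ⊆ t ∧ ((M.det : ℤ) : K) ≠ 0 := by
  obtain ⟨b, hbt, hsb, hspan, hb⟩ := exists_linearIndepOn_extension hs hst
  have htop : ⊤ ≤ Submodule.span K (Set.range fun x : b => castVec K x.1) := by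
    rw [← ht, Set.range_comp' , Subtype.range_coe]
    exact Submodule.span_le.2 hspan
  let B := Module.Basis.mk hb htop
  let e : b ≃ Fin m := B.indexEquiv (Pi.basisFun K (Fin m))
  refine ⟨Matrix.of fun i => (e.symm i).1, ?_, ?_, ?_, ?_⟩
  · exact Subtype.val_injective.comp e.symm.injective
  · exact fun v hv => ⟨e ⟨v, hsb hv⟩, congrArg Subtype.val (e.symm_apply_apply _)⟩
  · rintro _ ⟨i, rfl⟩
    exact hbt (e.symm i).2
  · rw [Int.cast_det]
    have hli : LinearIndependent K
        (Matrix.of fun i j => (((e.symm i).1 j : ℤ) : K) : Matrix (Fin m) (Fin m) K).row :=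
      hb.comp _ e.symm.injective
    have := Matrix.linearIndependent_rows_iff_isUnit.1 hli
    exact ((Matrix.isUnit_iff_isUnit_det _).1 this).ne_zero

theorem linearIndepOn_of_subset_range {K : Type*} [Field K] {s : Set (Fin m → ℤ)}
    {M : Matrix (Fin m) (Fin m) ℤ} (hM : Function.Injective M) (hs : s ⊆ Set.range M)
    (hdet : ((M.det : ℤ) : K) ≠ 0) : LinearIndepOn K (castVec K) s := by
  refine LinearIndepOn.mono ?_ hs
  rw [linearIndepOn_range_iff hM]
  rw [Int.cast_det] at hdet
  exact Matrix.linearIndependent_rows_of_det_ne_zero hdet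

theorem span_castVec_single {K : Type*} [Field K] :
    Submodule.span K (castVec K '' (Set.range fun j : Fin m => (Pi.single j 1 : Fin m → ℤ))) = ⊤ := by
  rw [← Set.range_comp]
  convert (Pi.basisFun K (Fin m)).span_eq
  ext i j
  simp [castVec, Pi.single_apply]

/-- Independence modulo a prime lifts to characteristic zero. -/
theorem linearIndepOn_castVec_of_field {K L : Type*} [Field K] [Field L] [CharZero L]
    {s : Set (Fin m → ℤ)} (hs : LinearIndepOn K (castVec K) s) :
    LinearIndepOn L (castVec L) s := by
  -- The coordinate vectors are adjoined only to make the set spanning.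
  obtain ⟨M, hM, hsM, -, hdet⟩ := exists_matrix_of_linearIndepOn
    (t := s ∪ Set.range fun j : Fin m => (Pi.single j 1 : Fin m → ℤ)) Set.subset_union_left hs
    (top_unique (span_castVec_single.symm.le.trans
      (Submodule.span_mono (Set.image_mono Set.subset_union_right))))
  refine linearIndepOn_of_subset_range hM hsM ?_
  have : M.det ≠ 0 := fun h => hdet (by simp [h])
  exact_mod_cast this

theorem four_pow_lt {m q : ℕ} (hm : 3 ≤ m)
    (hqm : q > if m ≤ 5 then 2 ^ (m - 2) else 8 * 3 ^ (m - 5)) : 4 ^ (m - 1) < m * q ^ 2 := by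
  have hq : 2 ^ (m - 2) < q := by
    split_ifs at hqm with h
    · exact hqm
    · refine lt_of_le_of_lt ?_ hqm
      obtain ⟨k, rfl⟩ := Nat.exists_eq_add_of_le (show 5 ≤ m by omega)
      rw [show 5 + k - 2 = 3 + k by omega, show 5 + k - 5 = k by omega, pow_add]
      exact Nat.mul_le_mul (by norm_num) (Nat.pow_le_pow_left (by norm_num) k)
  -- For `m ≥ 4` the factor `m` absorbs the 4 in `4^(m-1) = 4 · (2^(m-2))²`; for `m = 3`,
  -- integrality gives `q ≥ 3` and `16 < 27`.
  rcases hm.eq_or_lt with rfl | h4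
  · norm_num at hq ⊢
    nlinarith
  · have h1 : (2 ^ (m - 2)) ^ 2 < q ^ 2 := Nat.pow_lt_pow_left hq (by norm_num)
    have h2 : 4 ^ (m - 1) = 4 * (2 ^ (m - 2)) ^ 2 := by
      rw [← pow_mul, mul_comm (m - 2), pow_mul, show m - 1 = m - 2 + 1 by omega, pow_succ']
      norm_num
    rw [h2]
    nlinarith

/-- This is where `q` must be large: a nonzero determinant divisible by `q` would have square at
least `q²`, against `mul_det_sq_le`. -/
theorem linearIndepOn_zmod_of_real (hm : 3 ≤ m) {q : ℕ} [Fact q.Prime]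
    (hq : 4 ^ (m - 1) < m * q ^ 2) {s : Set (Fin m → ℤ)} (hsN : s ⊆ normals m)
    (hs : LinearIndepOn ℝ (castVec ℝ) s) : LinearIndepOn (ZMod q) (castVec (ZMod q)) s := by
  let z : Fin m := ⟨0, by omega⟩
  let e : Fin m → ℤ := Pi.single z 1
  have hsum : s ⊆ {v | ∑ j, v j = 0} := fun v hv => sum_eq_zero_of_mem_normals (hsN hv)
  -- The coordinate sum kills all normals but not `e`.
  have hli : LinearIndepOn ℝ (castVec ℝ) (insert e s) := by
    refine hs.insert fun hmem => ?_
    have : Submodule.span ℝ (castVec ℝ '' s) ≤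
        LinearMap.ker (∑ j, LinearMap.proj j : (Fin m → ℝ) →ₗ[ℝ] ℝ) := by
      rw [Submodule.span_le]
      rintro _ ⟨v, hv, rfl⟩
      have := hsum hv
      simp only [Set.mem_ofPred_eq] at this
      simp only [SetLike.mem_coe, LinearMap.mem_ker, LinearMap.sum_apply, LinearMap.proj_apply, castVec]
      exact_mod_cast this
    have h := this hmem
    simp [castVec, e, Pi.single_apply] at h
  have ht : Submodule.span ℝ (castVec ℝ '' (insert e (normals m : Set (Fin m → ℤ)))) = ⊤ := by
    refine top_unique ?_
    rw [← span_castVec_single, Submodule.span_le]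
    rintro _ ⟨_, ⟨j, rfl⟩, rfl⟩
    have he : castVec ℝ e ∈ Submodule.span ℝ (castVec ℝ '' (insert e (normals m : Set (Fin m → ℤ)))) :=
      Submodule.subset_span ⟨e, by simp, rfl⟩
    by_cases hj : j = z
    · rw [hj]; exact he
    · have hd : castVec ℝ (Pi.single z 1 - Pi.single j 1 : Fin m → ℤ) ∈
          Submodule.span ℝ (castVec ℝ '' (insert e (normals m : Set (Fin m → ℤ)))) := by
        refine Submodule.subset_span ⟨_, Set.mem_insert_of_mem _ (mem_normals.2 (Or.inl
          ⟨z, j, ?_, rfl⟩)), rfl⟩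
        exact Fin.lt_def.2 (Nat.pos_of_ne_zero fun h => hj (Fin.ext h))
      have := Submodule.sub_mem _ he hd
      have hsub : castVec ℝ (Pi.single j 1 : Fin m → ℤ) =
          castVec ℝ e - castVec ℝ (Pi.single z 1 - Pi.single j 1 : Fin m → ℤ) := by
        ext i
        simp [castVec, e]
      rwa [← hsub] at this
  obtain ⟨M, hM, hsM, hMt, hdet⟩ := exists_matrix_of_linearIndepOn
    (Set.insert_subset_insert hsN) hli ht
  refine linearIndepOn_of_subset_range hM ((Set.subset_insert _ _).trans hsM) ?_
  obtain ⟨i₀, hi₀⟩ := hsM (Set.mem_insert e s)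
  have hN : ∀ i, i ≠ i₀ → M i ∈ normals m := by
    intro i hi
    rcases hMt ⟨i, rfl⟩ with h | h
    · exact absurd (hM (h.trans hi₀.symm)) hi
    · exact h
  have hb := mul_det_sq_le M i₀ z hi₀ (fun i hi => sum_eq_zero_of_mem_normals (hN i hi))
    (fun i hi => sum_sq_le_of_mem_normals (hN i hi))
  intro h0
  rw [ZMod.intCast_zmod_eq_zero_iff_dvd] at h0
  have hne : M.det ≠ 0 := fun h => hdet (by simp [h])
  have hle : (q : ℤ) ^ 2 ≤ M.det ^ 2 := by
    rw [sq_le_sq]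
    simpa using Int.le_of_dvd (abs_pos.2 hne) ((dvd_abs _ _).2 h0)
  have hq' : (4 : ℤ) ^ (m - 1) < m * q ^ 2 := by exact_mod_cast hq
  have : (m : ℤ) * q ^ 2 ≤ m * M.det ^ 2 := mul_le_mul_of_nonneg_left hle (by positivity)
  linarith

/-- The rank of a finite set of integer vectors over `K` is the maximal size of a `K`-independent
subset; so it grows if independent subsets remain independent. -/
theorem finrank_span_castVec_le {K L : Type*} [Field K] [Field L] {s : Set (Fin m → ℤ)}
    (h : ∀ t ⊆ s, LinearIndepOn K (castVec K) t → LinearIndepOn L (castVec L) t) :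
    Module.finrank K (Submodule.span K (castVec K '' s)) ≤
      Module.finrank L (Submodule.span L (castVec L '' s)) := by
  obtain ⟨b, hbs, -, hspan, hb⟩ := exists_linearIndepOn_extension
    (linearIndepOn_empty K (castVec (m := m) K)) (Set.empty_subset s)
  have hfin : Finite b := hb.finite
  have : Fintype b := Fintype.ofFinite b
  have h1 : Submodule.span K (castVec K '' s) = Submodule.span K (castVec K '' b) :=
    le_antisymm (Submodule.span_le.2 hspan) (Submodule.span_mono (Set.image_mono hbs))
  have h2 := finrank_span_eq_card hb
  have h3 := finrank_span_eq_card (h b hbs hb)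
  have h4 : Submodule.span L (castVec L '' b) ≤ Submodule.span L (castVec L '' s) :=
    Submodule.span_mono (Set.image_mono hbs)
  have h5 := Submodule.finrank_mono h4
  rw [h1, Set.image_eq_range, h2]
  rw [Set.image_eq_range, h3] at h5
  exact h5

/-- The hyperplane orthogonal to an integer vector. -/
def hyperplane (K : Type*) [Field K] (v : Fin m → ℤ) : Submodule K (Fin m → K) where
  carrier := {x | castVec K v ⬝ᵥ x = 0}
  add_mem' {x y} hx hy := by
    simp only [Set.mem_ofPred_eq] at *
    rw [dotProduct_add, hx, hy, add_zero]
  zero_mem' := by simp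
  smul_mem' c x hx := by
    simp only [Set.mem_ofPred_eq] at *
    rw [dotProduct_smul, hx, smul_zero]

theorem mem_hyperplane {K : Type*} [Field K] {v : Fin m → ℤ} {x : Fin m → K} :
    x ∈ hyperplane K v ↔ castVec K v ⬝ᵥ x = 0 := Iff.rfl

theorem finrank_inf_hyperplane {K : Type*} [Field K] (s : Finset (Fin m → ℤ)) :
    Module.finrank K (s.inf (hyperplane K) : Submodule K (Fin m → K)) =
      m - Module.finrank K (Submodule.span K (castVec K '' (s : Set (Fin m → ℤ)))) := by
  let A : Matrix s (Fin m) K := Matrix.of fun v => castVec K v.1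
  have hker : (s.inf (hyperplane K) : Submodule K (Fin m → K)) = LinearMap.ker A.mulVecLin := by
    ext x
    simp only [Submodule.mem_finsetInf, mem_hyperplane, LinearMap.mem_ker, Matrix.mulVecLin_apply,
      funext_iff, Subtype.forall]
    rfl
  have h1 := A.mulVecLin.finrank_range_add_finrank_ker
  have h2 : A.rank = Module.finrank K (Submodule.span K (castVec K '' (s : Set (Fin m → ℤ)))) := by
    rw [Matrix.rank_eq_finrank_span_row, Set.image_eq_range]
    rfl
  rw [hker, ← h2, Matrix.rank]
  rw [Module.finrank_fin_fun] at h1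
  omega

theorem finrank_inf_hyperplane_zmod (hm : 3 ≤ m) {q : ℕ} [Fact q.Prime]
    (hq : 4 ^ (m - 1) < m * q ^ 2) {s : Finset (Fin m → ℤ)} (hs : s ⊆ normals m) :
    Module.finrank ℝ (s.inf (hyperplane ℝ) : Submodule ℝ (Fin m → ℝ)) =
      Module.finrank (ZMod q) (s.inf (hyperplane (ZMod q)) : Submodule _ (Fin m → ZMod q)) := by
  rw [finrank_inf_hyperplane, finrank_inf_hyperplane]
  congr 1
  refine le_antisymm (finrank_span_castVec_le fun t ht h => ?_)
    (finrank_span_castVec_le fun t _ h => linearIndepOn_castVec_of_field h)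
  exact linearIndepOn_zmod_of_real hm hq (ht.trans (Finset.coe_subset.2 hs)) h

end Normals
end MidArrangement

namespace MidArrangement

/-! ### Inclusion-exclusion and Whitney's formula -/

section Whitney

theorem sum_powerset_neg_one_pow_card_filter {ι : Type*} [DecidableEq ι] (N : Finset ι)
    (P : ι → Prop) [DecidablePred P] :
    ∑ S ∈ N.powerset with (∀ v ∈ S, P v), (-1 : ℤ) ^ S.card =
      if ∀ v ∈ N, ¬ P v then 1 else 0 := by
  have h : N.powerset.filter (fun S => ∀ v ∈ S, P v) = (N.filter P).powerset := by
    ext S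
    simp only [Finset.mem_filter, Finset.mem_powerset, Finset.subset_iff]
    exact ⟨fun h v hv => ⟨h.1 hv, h.2 v hv⟩, fun h => ⟨fun v hv => (h hv).1, fun v hv => (h hv).2⟩⟩
  rw [h, Finset.sum_powerset_neg_one_pow_card]
  simp only [Finset.filter_eq_empty_iff]

/-- Inclusion-exclusion for the complement of a family of sets in a finite type. -/
theorem sum_neg_one_pow_mul_card {ι V : Type*} [DecidableEq ι] [Fintype V] (N : Finset ι)
    (P : ι → V → Prop) [∀ v, DecidablePred (P v)] :
    ∑ S ∈ N.powerset, (-1 : ℤ) ^ S.card * (Finset.univ.filter fun x => ∀ v ∈ S, P v x).card =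
      (Finset.univ.filter fun x => ∀ v ∈ N, ¬ P v x).card := by
  simp only [Finset.card_filter, Nat.cast_sum, Finset.mul_sum, Nat.cast_ite, Nat.cast_one,
    Nat.cast_zero, mul_ite, mul_one, mul_zero]
  rw [Finset.sum_comm]
  refine Finset.sum_congr rfl fun x _ => ?_
  rw [← sum_powerset_neg_one_pow_card_filter N (fun v => P v x), Finset.sum_filter]

variable {K V ι : Type*} [Field K] [AddCommGroup V] [Module K V]
  {A : Finset (Submodule K V)} {N : Finset ι} {H : ι → Submodule K V}

namespace IntersectionPoset

theorem toSubmodule_injective : Function.Injective (toSubmodule (A := A)) :=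
  fun _ _ h => Subtype.ext h

/-- The edge cut out by a subfamily of the hyperplanes. -/
def ofFamily (hA : ∀ X, X ∈ A ↔ ∃ v ∈ N, H v = X) (S : N.powerset) : IntersectionPoset A :=
  ⟨OrderDual.toDual (S.1.inf H), by
    classical
    refine ⟨S.1.image H, ?_, ?_⟩
    · intro X hX
      obtain ⟨v, hv, rfl⟩ := Finset.mem_image.1 hX
      exact (hA _).2 ⟨v, Finset.mem_powerset.1 S.2 hv, rfl⟩
    · rw [Finset.coe_image, Finset.inf_eq_iInf, sInf_image]
      rfl⟩

theorem ofFamily_toSubmodule (hA : ∀ X, X ∈ A ↔ ∃ v ∈ N, H v = X) (S : N.powerset) :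
    (ofFamily hA S).toSubmodule = S.1.inf H := rfl

theorem exists_mem_of_ne_bot {X : IntersectionPoset A} (hX : X ≠ ⊥) :
    ∃ Y ∈ A, X.toSubmodule ≤ Y := by
  obtain ⟨X, B, hB, rfl⟩ := X
  obtain ⟨Y, hY⟩ : B.Nonempty := by
    rw [Finset.nonempty_iff_ne_empty]
    rintro rfl
    exact hX (toSubmodule_injective ((by simp [toSubmodule] : _ = ⊤).trans bot_toSubmodule.symm))
  exact ⟨Y, hB hY, sInf_le hY⟩

/-- Whitney's formula for the Möbius function of an arrangement. -/
theorem moebius_eq_sum [DecidableEq ι] (hA : ∀ X, X ∈ A ↔ ∃ v ∈ N, H v = X)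
    (hH : ∀ v ∈ N, H v ≠ ⊤) (X : IntersectionPoset A) :
    X.moebius = ∑ S : N.powerset with ofFamily hA S = X, (-1 : ℤ) ^ S.1.card := by
  classical
  set f : IntersectionPoset A → ℤ :=
    fun X => ∑ S : N.powerset with ofFamily hA S = X, (-1 : ℤ) ^ S.1.card with hf
  -- The candidate `f` satisfies the recursion that defines the Möbius function: the sets whose edge
  -- is at most `X` are those of hyperplanes containing `X`, and their alternating sum vanishes
  -- unless there are none.
  have hsum : ∀ X, ∑ Y ∈ Finset.Icc ⊥ X, f Y = if ⊥ = X then 1 else 0 := by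
    intro X
    have h1 : ∑ Y ∈ Finset.Icc ⊥ X, f Y =
        ∑ S : N.powerset with (∀ v ∈ S.1, X.toSubmodule ≤ H v), (-1 : ℤ) ^ S.1.card := by
      rw [hf, Finset.sum_fiberwise_eq_sum_filter]
      refine Finset.sum_congr (Finset.filter_congr fun S _ => ?_) fun _ _ => rfl
      rw [Finset.mem_Icc, le_iff _ X, ofFamily_toSubmodule, Finset.le_inf_iff]
      simp
    rw [h1, Finset.sum_filter,
      Finset.sum_coe_sort N.powerset
        (fun S => if ∀ v ∈ S, X.toSubmodule ≤ H v then (-1 : ℤ) ^ S.card else 0),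
      ← Finset.sum_filter, sum_powerset_neg_one_pow_card_filter]
    congr 1
    refine propext ⟨fun h => ?_, ?_⟩
    · by_contra hX
      obtain ⟨Y, hY, hXY⟩ := exists_mem_of_ne_bot (Ne.symm hX)
      obtain ⟨v, hv, rfl⟩ := (hA Y).1 hY
      exact h v hv hXY
    · rintro rfl v hv h
      rw [bot_toSubmodule] at h
      exact hH v hv (top_unique h)
  induction X using WellFoundedLT.induction with
  | ind X ih =>
    have h1 := hsum X
    have h2 := IncidenceAlgebra.sum_Icc_mu_right (𝕜 := ℤ) (⊥ : IntersectionPoset A) X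
    rw [← Finset.Ico_insert_right bot_le, Finset.sum_insert (by simp)] at h1 h2
    have h3 : ∑ Y ∈ Finset.Ico ⊥ X, IncidenceAlgebra.mu ℤ ⊥ Y = ∑ Y ∈ Finset.Ico ⊥ X, f Y :=
      Finset.sum_congr rfl fun Y hY => ih Y (Finset.mem_Ico.1 hY).2
    rw [h3] at h2
    change IncidenceAlgebra.mu ℤ ⊥ X = f X
    exact add_right_cancel (h2.trans h1.symm)

end IntersectionPoset

open IntersectionPoset in
/-- Whitney's formula for the characteristic polynomial of an arrangement. -/
theorem eval_charPoly_eq_sum [DecidableEq ι] (hA : ∀ X, X ∈ A ↔ ∃ v ∈ N, H v = X)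
    (hH : ∀ v ∈ N, H v ≠ ⊤) (t : ℤ) :
    (charPoly A).eval t = ∑ S ∈ N.powerset,
      (-1 : ℤ) ^ S.card * t ^ Module.finrank K (S.inf H : Submodule K V) := by
  rw [← Finset.sum_coe_sort N.powerset, charPoly, Polynomial.eval_finsetSum,
    ← Finset.sum_fiberwise (Finset.univ) (ofFamily hA)]
  refine Finset.sum_congr rfl fun X _ => ?_
  rw [moebius_eq_sum hA hH, Polynomial.eval_mul, Polynomial.eval_C, Polynomial.eval_pow,
    Polynomial.eval_X, Finset.sum_mul]
  refine Finset.sum_congr rfl fun S hS => ?_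
  rw [← (Finset.mem_filter.1 hS).2, ofFamily_toSubmodule]

end Whitney

/-! ### Counting points modulo `q` -/

section Count

variable {m : ℕ}

theorem castVec_dotProduct_braid {K : Type*} [Field K] (i j : Fin m) (x : Fin m → K) :
    castVec K (Pi.single i 1 - Pi.single j 1) ⬝ᵥ x = x i - x j := by
  simp [castVec, dotProduct, Pi.single_apply, sub_mul, Finset.sum_sub_distrib]

theorem castVec_dotProduct_mid {K : Type*} [Field K] (p q r s : Fin m) (x : Fin m → K) :
    castVec K (Pi.single p 1 + Pi.single q 1 - Pi.single r 1 - Pi.single s 1) ⬝ᵥ x =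
      x p + x q - x r - x s := by
  simp [castVec, dotProduct, Pi.single_apply, sub_mul, add_mul, Finset.sum_sub_distrib,
    Finset.sum_add_distrib]

theorem hyperplane_braid (K : Type*) [Field K] (i j : Fin m) :
    hyperplane K (Pi.single i 1 - Pi.single j 1) = braidHyperplane K i j := by
  ext x
  rw [mem_hyperplane, castVec_dotProduct_braid, sub_eq_zero]
  rfl

theorem hyperplane_mid (K : Type*) [Field K] (p q r s : Fin m) :
    hyperplane K (Pi.single p 1 + Pi.single q 1 - Pi.single r 1 - Pi.single s 1) =
      midHyperplane K p q r s := by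
  ext x
  rw [mem_hyperplane, castVec_dotProduct_mid, sub_sub, sub_eq_zero]
  rfl

theorem mem_midArrangement_iff {K : Type*} [Field K] (X : Submodule K (Fin m → K)) :
    X ∈ midArrangement K m ↔ ∃ v ∈ normals m, hyperplane K v = X := by
  simp only [midArrangement, Finset.mem_union, Finset.mem_image, Finset.mem_filter,
    Finset.mem_univ, true_and, Prod.exists, mem_normals]
  constructor
  · rintro (⟨i, j, hij, rfl⟩ | ⟨p, q, r, s, h, rfl⟩)
    · exact ⟨_, Or.inl ⟨i, j, hij, rfl⟩, hyperplane_braid K i j⟩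
    · exact ⟨_, Or.inr ⟨p, q, r, s, h, rfl⟩, hyperplane_mid K p q r s⟩
  · rintro ⟨_, ⟨i, j, hij, rfl⟩ | ⟨p, q, r, s, h, rfl⟩, rfl⟩
    · exact Or.inl ⟨i, j, hij, (hyperplane_braid K i j).symm⟩
    · exact Or.inr ⟨p, q, r, s, h, (hyperplane_mid K p q r s).symm⟩

theorem hyperplane_ne_top_of_mem_normals (K : Type*) [Field K] {v : Fin m → ℤ}
    (hv : v ∈ normals m) : hyperplane K v ≠ ⊤ := by
  intro h
  have hmem : ∀ x, castVec K v ⬝ᵥ x = 0 := fun x => mem_hyperplane.1 (h ▸ Submodule.mem_top)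
  rcases mem_normals.1 hv with ⟨i, j, hij, rfl⟩ | ⟨p, q, r, s, hq, rfl⟩
  · have := hmem (Pi.single i 1)
    rw [castVec_dotProduct_braid] at this
    simp [hij.ne'] at this
  · simp only [quadruples, Finset.mem_filter, Finset.mem_univ, true_and] at hq
    have := hmem (Pi.single p 1)
    rw [castVec_dotProduct_mid] at this
    simp [hq.1.ne', hq.2.1.ne', (hq.2.1.trans hq.2.2.1).ne'] at this

/-- The finite field method for the mid-hyperplane arrangement: its characteristic polynomial
counts the points of the complement modulo a large prime. -/
theorem eval_charPoly_midArrangement (hm : 3 ≤ m) {q : ℕ} [Fact q.Prime]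
    (hq : 4 ^ (m - 1) < m * q ^ 2) :
    (charPoly (midArrangement ℝ m)).eval (q : ℤ) =
      ((complement (midArrangement (ZMod q) m)).ncard : ℤ) := by
  classical
  rw [eval_charPoly_eq_sum mem_midArrangement_iff
    (fun v hv => hyperplane_ne_top_of_mem_normals ℝ hv)]
  have hc : complement (midArrangement (ZMod q) m) =
      ((Finset.univ.filter fun x => ∀ v ∈ normals m, ¬ x ∈ hyperplane (ZMod q) v :
        Finset (Fin m → ZMod q)) : Set (Fin m → ZMod q)) := by
    ext x
    simp only [complement, Set.mem_ofPred_eq, mem_midArrangement_iff, Finset.coe_filter,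
      Finset.mem_univ, true_and]
    exact ⟨fun h v hv => h _ ⟨v, hv, rfl⟩, by rintro h _ ⟨v, hv, rfl⟩; exact h v hv⟩
  rw [hc, Set.ncard_coe_finset, ← sum_neg_one_pow_mul_card]
  refine Finset.sum_congr rfl fun S hS => ?_
  rw [finrank_inf_hyperplane_zmod hm hq (Finset.mem_powerset.1 hS)]
  congr 1
  have h := Module.card_eq_pow_finrank (K := ZMod q)
    (V := (S.inf (hyperplane (ZMod q)) : Submodule _ (Fin m → ZMod q)))
  rw [ZMod.card] at h
  rw [← Nat.cast_pow, ← h, Fintype.card_subtype]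
  congr 2
  ext x
  simp [Submodule.mem_finsetInf]

/-- Normals have sum zero, so each vanishes on constant vectors, and scaling by a unit preserves its
zero set. -/
theorem mem_complement_affine {q : ℕ} [Fact q.Prime] {a b : ZMod q} (hb : b ≠ 0)
    {x : Fin m → ZMod q} :
    (fun i => a + b * x i) ∈ complement (midArrangement (ZMod q) m) ↔
      x ∈ complement (midArrangement (ZMod q) m) := by
  have key : ∀ v ∈ normals m, (fun i => a + b * x i) ∈ hyperplane (ZMod q) v ↔
      x ∈ hyperplane (ZMod q) v := by
    intro v hv
    have h0 : castVec (ZMod q) v ⬝ᵥ (fun _ => a) = 0 := by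
      have := sum_eq_zero_of_mem_normals hv
      simp only [dotProduct, castVec, ← Finset.sum_mul, ← Int.cast_sum, this]
      simp
    rw [mem_hyperplane, mem_hyperplane,
      show (fun i => a + b * x i) = (fun _ => a) + b • x from rfl, dotProduct_add, h0, zero_add,
      dotProduct_smul, smul_eq_zero]
    simp [hb]
  simp only [complement, Set.mem_ofPred_eq, mem_midArrangement_iff, forall_exists_index, and_imp,
    forall_apply_eq_imp_iff₂]
  exact forall₂_congr fun v hv => not_congr (key v hv)

/-- The affine group acts freely on the complement, and every orbit has one normalized point. -/
theorem ncard_complement (hm : 3 ≤ m) {q : ℕ} [Fact q.Prime] :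
    (complement (midArrangement (ZMod q) m)).ncard =
      q * (q - 1) * (normalizedPoints m hm q).ncard := by
  let i₀ : Fin m := ⟨0, by omega⟩
  let i₁ : Fin m := ⟨1, by omega⟩
  have hne : ∀ x ∈ complement (midArrangement (ZMod q) m), x i₁ - x i₀ ≠ 0 := by
    intro x hx h
    refine hx (braidHyperplane _ i₀ i₁) ((mem_midArrangement_iff _).2 ⟨_, mem_normals.2
      (Or.inl ⟨i₀, i₁, ?_, rfl⟩), hyperplane_braid _ _ _⟩) (sub_eq_zero.1 h).symm
    simp [i₀, i₁]
  -- Each `x` is `a + b y` with `a = x i₀`, `b = x i₁ - x i₀` and `y` normalized; these are forced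
  -- by `y i₀ = 0` and `y i₁ = 1`.
  let e : complement (midArrangement (ZMod q) m) ≃
      (ZMod q × {b : ZMod q // b ≠ 0}) × normalizedPoints m hm q :=
    { toFun := fun x => ((x.1 i₀, ⟨x.1 i₁ - x.1 i₀, hne _ x.2⟩),
        ⟨fun i => (x.1 i₁ - x.1 i₀)⁻¹ * (x.1 i - x.1 i₀), by
          have h := hne _ x.2
          refine ⟨?_, ?_, ?_⟩
          · rw [← mem_complement_affine (a := x.1 i₀) h]
            convert x.2 using 1
            ext i
            field_simp
            ring
          · simp [i₀]
          · exact inv_mul_cancel₀ h⟩)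
      invFun := fun y => ⟨fun i => y.1.1 + y.1.2.1 * y.2.1 i,
        (mem_complement_affine y.1.2.2).2 y.2.2.1⟩
      left_inv := by
        intro x
        have h := hne _ x.2
        ext i
        simp only
        field_simp
        ring
      right_inv := by
        rintro ⟨⟨a, b, hb⟩, y, hy, hy0, hy1⟩
        have h0 : y i₀ = 0 := hy0
        have h1 : y i₁ = 1 := hy1
        simp [h0, h1, hb] }
  have hcard := Nat.card_congr e
  have hunits : Nat.card {b : ZMod q // b ≠ 0} = q - 1 := by
    rw [Nat.card_eq_fintype_card, Fintype.card_subtype_compl]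
    simp [ZMod.card]
  rwa [Nat.card_prod, Nat.card_prod, hunits, Nat.card_zmod, Nat.card_coe_set_eq,
    Nat.card_coe_set_eq] at hcard

end Count

end MidArrangement

theorem theorem2p7 (m : ℕ) (hm : 3 ≤ m) (q : ℕ) (hq : q.Prime)
    (hqm : q > if m ≤ 5 then 2 ^ (m - 2) else 8 * 3 ^ (m - 5)) :
    (((MidArrangement.charPoly (MidArrangement.midArrangement ℝ m)).eval (q : ℤ) : ℤ) : ℚ) /
        ((q : ℚ) * ((q : ℚ) - 1)) =
      ((MidArrangement.normalizedPoints m hm q).ncard : ℚ) := by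
  have : Fact q.Prime := ⟨hq⟩
  have h1 : (1 : ℚ) < q := by exact_mod_cast hq.one_lt
  rw [MidArrangement.eval_charPoly_midArrangement hm (MidArrangement.four_pow_lt hm hqm),
    MidArrangement.ncard_complement hm, Int.cast_natCast, Nat.cast_mul, Nat.cast_mul,
    Nat.cast_sub hq.one_le, Nat.cast_one]
  exact mul_div_cancel_left₀ _ (mul_ne_zero (by linarith) (by linarith))
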